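/- Let $\log=\log_2$. For a positive integer $N$, a DRSample graph on the node set $[N]=\{1,\dots,N\}$ is the random directed acyclic graph $G_N$ with the edges $(v-1,v)$ for $2\le v\le N$ and an edge $(r(v),v)$ for $3\le v\le N$. Here the $r(v)$ are independent, and each is sampled as follows: choose an index $i$ uniformly from $\{1,\dots,\lfloor\log v\rfloor\}$, then choose $r(v)$ uniformly from the bucket $\{u\in[N] : 2^{i-1}<v-u\le 2^i\}$. For a finite directed acyclic graph $G=(V,E)$ write $\mathsf{parents}(W)=\{u : (u,w)\in E \text{ for some } w\in W\}$ for $W\subseteq V$, and let $\mathsf{sinks}(G)$ be the set of nodes without outgoing edges. A legal parallel quantum pebbling of $G$ is a sequence $P=(P_0,\dots,P_t)$ of subsets of $V$ with $P_0=\varnothing$ and $P_t=\mathsf{sinks}(G)$ such that, for each $1\le i\le t$, $\mathsf{parents}(P_i\setminus P_{i-1})\cup\mathsf{parents}(P_{i-1}\setminus P_i)\subseteq P_{i-1}\cap P_i$. Its space-time cost is $t\cdot\max_{1\le i\le t}|P_i|$. The parallel quantum space-time complexity $\Pi_{st}(G)$ is the minimum of this cost over all legal parallel quantum pebblings of $G$.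 Then with high probability $\Pi_{st}(G_N)=O\!\left(\frac{N^2\log\log N}{\log N}\right)$. Precisely: there is a constant $C>0$ such that for every $k\in\mathbb{N}$ and all sufficiently large $N$ (depending on $k$), $$\Pr\left[\Pi_{st}(G_N)\le C\,\frac{N^2\log\log N}{\log N}\right]\ \ge\ 1-\frac1{N^k}.$$ -/

import Mathlib

open Filter
open scoped ENNReal

noncomputable section

namespace QPebble

/-! ### The parallel quantum pebbling game on a directed graph -/

section Pebbling

variable {V : Type} [DecidableEq V]

/-- `parents(W, G)`: all tails of edges of `G` whose head lies in `W`. -/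
def parents (G : Digraph V) (W : Set V) : Set V := {u | ∃ w ∈ W, G.Adj u w}

/-- The nodes of `G` without outgoing edges. -/
def sinks (G : Digraph V) : Set V := {v | ∀ u, ¬ G.Adj v u}

/-- `(P 0, …, P t)` is a legal parallel quantum pebbling of `G` with target set `T`
(values `P i` with `i > t` play no role). -/
structure IsQuantumPebbling (G : Digraph V) (T : Set V) (t : ℕ) (P : ℕ → Finset V) : Prop where
  /-- No pebbles at the beginning. -/
  start : P 0 = ∅
  /-- The final configuration is exactly the target set. -/
  target : (P t : Set V) = T
  /-- A pebble is placed only if all parents were pebbled at the end of the previous round. -/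
  place : ∀ i < t, ∀ x ∈ P (i + 1) \ P i, parents G {x} ⊆ (P i : Set V)
  /-- A pebble is removed only if all parents were pebbled at the end of the previous round. -/
  remove : ∀ i < t, ∀ x ∈ P i \ P (i + 1), parents G {x} ⊆ (P i : Set V)
  /-- Pebbles used for placing or removing other pebbles are kept during the round. -/
  reversible : ∀ i < t,
    parents G (↑(P (i + 1) \ P i)) ∪ parents G (↑(P i \ P (i + 1))) ⊆ (P (i + 1) : Set V)

/-- Space of the pebbling `(P 0, …, P t)`: the maximum of `|P i|` over `1 ≤ i ≤ t`. -/
def space (t : ℕ) (P : ℕ → Finset V) : ℕ := (Finset.Icc 1 t).sup fun i => (P i).card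

/-- Parallel quantum space-time complexity of `G` with target set `T`: the minimum of
time times space over all legal parallel quantum pebblings (`⊤` if there is none). -/
def stComplexityTarget (G : Digraph V) (T : Set V) : ℕ∞ :=
  ⨅ (t : ℕ) (P : ℕ → Finset V) (_ : IsQuantumPebbling G T t P), ((t * space t P : ℕ) : ℕ∞)

/-- Parallel quantum space-time complexity of `G`, the target set being the sinks. -/
def stComplexity (G : Digraph V) : ℕ∞ := stComplexityTarget G (sinks G)

end Pebbling

/-! ### DRSample -/

/-- The node set `{1, …, N}`. -/
abbrev Node (N : ℕ) : Type := ↥(Finset.Icc 1 N)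

/-- The uniform distribution on `s`; the outcome is `none` if `s` is empty. -/
def uniformOrNone {α : Type} (s : Finset α) : PMF (Option α) :=
  open scoped Classical in
  if h : s.Nonempty then (PMF.uniformOfFinset s h).map some else PMF.pure none

/-- The bucket indices `1 ≤ i ≤ log₂ v`. -/
def bucketIndices (v : ℕ) : Finset ℕ := Finset.Icc 1 (Nat.log 2 v)

/-- The `i`-th bucket of `v`: the nodes `u ∈ {1, …, N}` with `2 ^ (i - 1) < v - u ≤ 2 ^ i`,
the difference being taken in the integers. -/
def bucket {N : ℕ} (v : Node N) (i : ℕ) : Finset (Node N) :=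
  Finset.univ.filter fun u =>
    (2 : ℤ) ^ (i - 1) < (v : ℤ) - (u : ℤ) ∧ (v : ℤ) - (u : ℤ) ≤ (2 : ℤ) ^ i

/-- Law of the random predecessor `r(v)`: a uniform bucket index, then a uniform node of that
bucket. Only `v = 1` (no bucket index) and `v = 2` (its only bucket is empty) have
no random predecessor. -/
def predecessorLaw {N : ℕ} (v : Node N) : PMF (Option (Node N)) :=
  (uniformOrNone (bucketIndices v)).bind fun o =>
    match o with
    | none => PMF.pure none
    | some i => uniformOrNone (bucket v i)

/-- The law of independent random variables with laws `p i`. -/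
def productLaw {ι α : Type} [Fintype ι] [DecidableEq ι] [Fintype α] (p : ι → PMF α) :
    PMF (ι → α) :=
  PMF.ofFintype (fun ω => ∏ i, p i (ω i)) <| by
    rw [← Fintype.prod_sum]
    refine Finset.prod_eq_one fun i _ => ?_
    simpa only [tsum_fintype] using (p i).tsum_coe

/-- The graph on `{1, …, N}` with the edges `(v - 1, v)` and `(r(v), v)`. -/
def graphOf {N : ℕ} (r : Node N → Option (Node N)) : Digraph (Node N) where
  Adj u v := (u : ℕ) + 1 = v ∨ r v = some u

/-- The DRSample distribution on graphs with node set `{1, …, N}`: the predecessors `r(v)`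
are independent. -/
def drSample (N : ℕ) : PMF (Digraph (Node N)) :=
  (productLaw fun v : Node N => predecessorLaw v).map graphOf

end QPebble

end

/-! Cut the nodes into groups of about `N / log N` consecutive nodes. Pebble them in order; when a
group is complete, remove its pebbles in reverse order, except those on nodes with a child in a
later group. This is reversible: parents inside the group are smaller and still pebbled, parents
outside it were kept. The run has at most `2N` rounds, and reversing it while keeping the last node
pebbled leaves only the sink. The space is governed by the group size plus the number of crossing
tails (`stComplexityTarget_last_le`).

With `n = ⌊log N⌋` and `l = ⌊log n⌋`, take `A = 2 ^ (n - l)` and `L = 2 ^ (n - 2 * l)`. The first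
`L` nodes of all groups number only `O(A)`. Any other node reaches an earlier group only through a
bucket of index above `n - 2 * l`, which has probability at most `2 * l / n`
(`predecessorLaw_farOutcomes_le`). So about `2X` such edges are expected at most, where `X = N * l /
n`, and by independence `6X` is reached with probability at most `exp (-2X)` (`productLaw_le_card`).
This beats every power of `N`, and the cost is `O(N * X)`. -/

namespace QPebble

/-! ### Reversible moves and pebbling paths -/

section Paths

variable {V : Type} {G : Digraph V}

/-- One legal round of the parallel quantum pebbling game. -/
def LegalMove (G : Digraph V) (P Q : Finset V) : Prop :=
  ∀ x u, ¬ (x ∈ P ↔ x ∈ Q) → G.Adj u x → u ∈ P ∧ u ∈ Q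

theorem LegalMove.symm {P Q : Finset V} (h : LegalMove G P Q) : LegalMove G Q P :=
  fun x u hx hu => (h x u (fun e => hx e.symm) hu).symm

theorem LegalMove.insert [DecidableEq V] {P Q : Finset V} (h : LegalMove G P Q) (z : V) :
    LegalMove G (insert z P) (insert z Q) := by
  intro x u hx hu
  obtain ⟨h₁, h₂⟩ := h x u (fun e => hx (by simp only [Finset.mem_insert, e])) hu
  exact ⟨Finset.mem_insert_of_mem h₁, Finset.mem_insert_of_mem h₂⟩

/-- `PebblePath G s n X Y`: there are `n` legal rounds that lead from `X` to `Y` through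
configurations with at most `s` pebbles. -/
inductive PebblePath (G : Digraph V) (s : ℕ) : ℕ → Finset V → Finset V → Prop
  | refl (X : Finset V) : X.card ≤ s → PebblePath G s 0 X X
  | snoc {n : ℕ} {X Y Z : Finset V} :
      PebblePath G s n X Y → LegalMove G Y Z → Z.card ≤ s → PebblePath G s (n + 1) X Z

namespace PebblePath

variable {s m n : ℕ} {X Y Z : Finset V}

theorem card_left_le (h : PebblePath G s n X Y) : X.card ≤ s := by
  induction h with
  | refl X hX => exact hX
  | snoc _ _ _ ih => exact ih

theorem trans (h₁ : PebblePath G s m X Y) (h₂ : PebblePath G s n Y Z) :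
    PebblePath G s (m + n) X Z := by
  induction h₂ with
  | refl X hX => exact h₁
  | snoc _ hm hc ih => exact (ih h₁).snoc hm hc

theorem single (h : LegalMove G X Y) (hX : X.card ≤ s) (hY : Y.card ≤ s) :
    PebblePath G s 1 X Y :=
  (PebblePath.refl X hX).snoc h hY

theorem card_right_le (h : PebblePath G s n X Y) : Y.card ≤ s := by
  cases h <;> assumption

theorem symm (h : PebblePath G s n X Y) : PebblePath G s n Y X := by
  induction h with
  | refl X hX => exact .refl X hX
  | snoc h hm hc ih =>
    rw [add_comm]
    exact (single hm.symm hc h.card_right_le).trans ih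

/-- An additional permanent pebble never blocks a round; this lets a computation be undone while its
result stays pebbled. -/
theorem insert [DecidableEq V] (h : PebblePath G s n X Y) (z : V) :
    PebblePath G (s + 1) n (insert z X) (insert z Y) := by
  induction h with
  | refl X hX => exact .refl _ ((Finset.card_insert_le _ _).trans (by lia))
  | snoc _ hm hc ih => exact ih.snoc (hm.insert z) ((Finset.card_insert_le _ _).trans (by lia))

theorem mono {s' : ℕ} (h : PebblePath G s n X Y) (hs : s ≤ s') : PebblePath G s' n X Y := by
  induction h with
  | refl X hX => exact .refl _ (hX.trans hs)
  | snoc _ hm hc ih => exact ih.snoc hm (hc.trans hs)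

theorem exists_sequence (h : PebblePath G s n X Y) :
    ∃ P : ℕ → Finset V, P 0 = X ∧ P n = Y ∧ (∀ i < n, LegalMove G (P i) (P (i + 1))) ∧
      ∀ i ≤ n, (P i).card ≤ s := by
  induction h with
  | refl X hX => exact ⟨fun _ => X, rfl, rfl, by simp, fun _ _ => hX⟩
  | @snoc n X Y Z _ hm hc ih =>
    obtain ⟨P, h0, hn, hmv, hs⟩ := ih
    refine ⟨fun i => if i ≤ n then P i else Z, by simpa using h0, by simp, fun i hi => ?_,
      fun i _ => ?_⟩
    · rcases Nat.lt_succ_iff_lt_or_eq.mp hi with hi | rfl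
      · simpa [hi.le, Nat.succ_le_of_lt hi] using hmv i hi
      · simpa [hn] using hm
    · by_cases h : i ≤ n
      · simpa [h] using hs i h
      · simpa [h] using hc

theorem stComplexityTarget_le [DecidableEq V] {T : Set V} (h : PebblePath G s n ∅ X) (hX : (X : Set V) = T) :
    stComplexityTarget G T ≤ ((n * s : ℕ) : ℕ∞) := by
  obtain ⟨P, h0, hn, hmv, hs⟩ := h.exists_sequence
  have hP : IsQuantumPebbling G T n P := by
    refine ⟨h0, by rw [hn, hX], fun i hi x hx u hu => ?_, fun i hi x hx u hu => ?_,
      fun i hi u hu => ?_⟩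
    · obtain ⟨w, rfl, hw⟩ := hu
      rw [Finset.mem_sdiff] at hx
      exact (hmv i hi _ u (by tauto) hw).1
    · obtain ⟨w, rfl, hw⟩ := hu
      rw [Finset.mem_sdiff] at hx
      exact (hmv i hi _ u (by tauto) hw).1
    · rcases hu with ⟨w, hx, hw⟩ | ⟨w, hx, hw⟩ <;>
        · rw [Finset.mem_coe, Finset.mem_sdiff] at hx
          exact (hmv i hi _ u (by tauto) hw).2
  refine (iInf_le_of_le n <| iInf_le_of_le P <| iInf_le _ hP).trans ?_
  have : space n P ≤ s := Finset.sup_le fun i hi => hs i (Finset.mem_Icc.mp hi).2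
  exact_mod_cast Nat.mul_le_mul_left n this

/-- Compute a configuration that holds all parents of `z`, pebble `z`, and uncompute. -/
theorem stComplexityTarget_singleton_le [DecidableEq V] {z : V} (h : PebblePath G s n ∅ X)
    (hz : ∀ u, G.Adj u z → u ∈ X) :
    stComplexityTarget G {z} ≤ (((2 * n + 1) * (s + 1) : ℕ) : ℕ∞) := by
  have hback := h.symm.insert z
  have hmove : LegalMove G X (Insert.insert z X) := by
    intro x u hx hu
    have : x = z := by
      by_contra hne
      exact hx (by simp [hne])
    subst this
    exact ⟨hz u hu, Finset.mem_insert_of_mem (hz u hu)⟩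
  have hpath := ((h.mono (Nat.le_succ s)).snoc hmove hback.card_left_le).trans hback
  have hlen : n + 1 + n = 2 * n + 1 := by lia
  rw [hlen] at hpath
  exact hpath.stComplexityTarget_le (by simp)

end PebblePath

end Paths

/-! ### Pebbling a topologically ordered graph group by group -/

section Groups

variable {N : ℕ} {G : Digraph (Node N)}

/-- The nodes with a child in a later group, the groups being the maximal sets of nodes with the
same value of `v / A`. -/
noncomputable def crossingTails (G : Digraph (Node N)) (A : ℕ) : Finset (Node N) :=
  open scoped Classical in
  Finset.univ.filter fun u => ∃ v : Node N, G.Adj u v ∧ (u : ℕ) / A < (v : ℕ) / A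

theorem mem_crossingTails {A : ℕ} {u : Node N} :
    u ∈ crossingTails G A ↔ ∃ v : Node N, G.Adj u v ∧ (u : ℕ) / A < (v : ℕ) / A := by
  simp [crossingTails]

/-- The nodes up to `n` that have a child in a later group, or lie in group `q` and
before `b`. -/
noncomputable def groupConfig (G : Digraph (Node N)) (A n q b : ℕ) : Finset (Node N) :=
  open scoped Classical in
  Finset.univ.filter fun u =>
    (u : ℕ) ≤ n ∧ (u ∈ crossingTails G A ∨ ((u : ℕ) / A = q ∧ (u : ℕ) < b))

theorem mem_groupConfig {A n q b : ℕ} {u : Node N} :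
    u ∈ groupConfig G A n q b ↔
      (u : ℕ) ≤ n ∧ (u ∈ crossingTails G A ∨ ((u : ℕ) / A = q ∧ (u : ℕ) < b)) := by
  simp [groupConfig]

theorem card_groupConfig_le {A n q b : ℕ} (hA : 0 < A) :
    (groupConfig G A n q b).card ≤ (crossingTails G A).card + A := by
  classical
  have hsub : groupConfig G A n q b ⊆
      crossingTails G A ∪ Finset.univ.filter fun u : Node N => (u : ℕ) / A = q := by
    intro u hu
    rw [mem_groupConfig] at hu
    simp only [Finset.mem_union, Finset.mem_filter, Finset.mem_univ, true_and]
    tauto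
  refine (Finset.card_le_card hsub).trans ((Finset.card_union_le _ _).trans ?_)
  gcongr
  calc (Finset.univ.filter fun u : Node N => (u : ℕ) / A = q).card
      ≤ (Finset.Ico (q * A) (q * A + A)).card := by
        refine Finset.card_le_card_of_injOn (fun u => (u : ℕ)) (fun u hu => ?_)
          (Subtype.val_injective.injOn)
        simp only [Finset.coe_filter, Finset.mem_univ, true_and, Set.mem_ofPred_eq] at hu
        have h1 := Nat.div_add_mod (u : ℕ) A
        have h2 := Nat.mod_lt (u : ℕ) hA
        rw [hu, mul_comm] at h1
        simp only [Finset.coe_Ico, Set.mem_Ico]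
        lia
    _ = A := by simp

/-- The parents of a node of group `q` are pebbled if all smaller nodes of the group are. -/
theorem mem_groupConfig_of_adj (hG : ∀ u v, G.Adj u v → (u : ℕ) < v) {A n b : ℕ} {u v : Node N}
    (huv : G.Adj u v) (hn : (v : ℕ) ≤ n + 1) (hb : (v : ℕ) ≤ b) :
    u ∈ groupConfig G A n ((v : ℕ) / A) b := by
  have hlt := hG u v huv
  rw [mem_groupConfig]
  refine ⟨by lia, ?_⟩
  rcases (Nat.div_le_div_right hlt.le : (u : ℕ) / A ≤ (v : ℕ) / A).lt_or_eq with h | h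
  · exact Or.inl (mem_crossingTails.mpr ⟨v, huv, h⟩)
  · exact Or.inr ⟨h, by lia⟩

/-- Clearing a finished group in reverse order. -/
theorem pebblePath_clear_group (hG : ∀ u v, G.Adj u v → (u : ℕ) < v) {A : ℕ} (hA : 0 < A)
    (n q b j : ℕ) :
    PebblePath G ((crossingTails G A).card + A) j
      (groupConfig G A n q (b + j)) (groupConfig G A n q b) := by
  induction j with
  | zero => exact .refl _ (card_groupConfig_le hA)
  | succ j ih =>
    rw [add_comm j 1]
    refine (PebblePath.single ?_ (card_groupConfig_le hA) (card_groupConfig_le hA)).trans ih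
    intro x u hx hu
    have hxq : (x : ℕ) ≤ n ∧ (x : ℕ) / A = q ∧ (x : ℕ) = b + j := by
      simp only [mem_groupConfig] at hx
      grind
    obtain ⟨hxn, rfl, hxb⟩ := hxq
    exact ⟨mem_groupConfig_of_adj hG hu (by lia) (by lia),
      mem_groupConfig_of_adj hG hu (by lia) (by lia)⟩

/-- Induction on the node: one round places it, and on entering a new group `A` further rounds clear
the previous one. -/
theorem pebblePath_groups (hG : ∀ u v, G.Adj u v → (u : ℕ) < v) {A : ℕ} (hA : 0 < A) (n : ℕ) :
    PebblePath G ((crossingTails G A).card + A) (n + A * (n / A)) ∅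
      (groupConfig G A n (n / A) (n + 1)) := by
  induction n with
  | zero =>
    have : groupConfig G A 0 (0 / A) (0 + 1) = ∅ := by
      ext u
      have := (Finset.mem_Icc.mp u.2).1
      simp only [mem_groupConfig, Finset.notMem_empty, iff_false]
      lia
    rw [this]
    simpa using PebblePath.refl ∅ (by simp)
  | succ n ih =>
    have hplace : PebblePath G ((crossingTails G A).card + A) 1
        (groupConfig G A n ((n + 1) / A) (n + 1))
        (groupConfig G A (n + 1) ((n + 1) / A) (n + 1 + 1)) := by
      refine PebblePath.single ?_ (card_groupConfig_le hA) (card_groupConfig_le hA)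
      intro x u hx hu
      have hxn : (x : ℕ) = n + 1 := by
        simp only [mem_groupConfig] at hx
        grind
      rw [← hxn]
      exact ⟨mem_groupConfig_of_adj hG hu (by lia) (by lia),
        mem_groupConfig_of_adj hG hu (by lia) (by lia)⟩
    rcases Nat.eq_or_lt_of_le (Nat.div_le_div_right (Nat.le_succ n) : n / A ≤ (n + 1) / A)
      with h | h
    · have := ih.trans (h ▸ hplace)
      rw [← h]
      convert this using 1
      lia
    · have hq : (n + 1) / A = n / A + 1 := by
        rw [Nat.succ_div] at h ⊢
        split_ifs at h ⊢ <;> lia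
      have hdvd : A ∣ n + 1 := by
        rw [Nat.succ_div] at hq
        split_ifs at hq with hd
        · exact hd
        · lia
      have hn1 : n + 1 = A * (n / A) + A := by
        rw [← Nat.mul_div_cancel' hdvd, hq]; ring
      -- Group `0` lacks the node `0`, and kept tails are not removed; the corresponding rounds are
      -- idle, which is legal.
      have hclear := pebblePath_clear_group hG hA n (n / A) (A * (n / A)) A
      rw [← hn1] at hclear
      have hcfg : groupConfig G A n (n / A) (A * (n / A)) =
          groupConfig G A n ((n + 1) / A) (n + 1) := by
        ext u
        simp only [mem_groupConfig]
        have h1 : (u : ℕ) / A = n / A → ¬ (u : ℕ) < A * (n / A) := fun e => by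
          rw [← e]; exact not_lt.mpr (Nat.mul_div_le _ _)
        have h2 : (u : ℕ) ≤ n → ¬ (u : ℕ) / A = (n + 1) / A := fun hle => by
          have := (Nat.div_le_div_right hle : (u : ℕ) / A ≤ n / A)
          lia
        tauto
      rw [hcfg] at hclear
      convert (ih.trans hclear).trans hplace using 1
      rw [hq]; ring

/-- Pebbling the last node of a topologically ordered graph group by group. -/
theorem stComplexityTarget_last_le (hG : ∀ u v, G.Adj u v → (u : ℕ) < v) {A : ℕ} (hA : 0 < A)
    (z : Node N) :
    stComplexityTarget G {z} ≤
      (((4 * N + 1) * ((crossingTails G A).card + A + 1) : ℕ) : ℕ∞) := by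
  have hz := Finset.mem_Icc.mp z.2
  -- The run has at most `2 * N` rounds, hence `4 * N + 1` with its reversal. It already pebbles
  -- `z`, so the middle round is idle.
  have hlen : A * ((z : ℕ) / A) ≤ z := Nat.mul_div_le _ _
  refine ((pebblePath_groups hG hA z).stComplexityTarget_singleton_le
    fun u hu => mem_groupConfig_of_adj hG hu (by lia) (by lia)).trans ?_
  exact_mod_cast Nat.mul_le_mul_right _ (by lia)

end Groups

/-! ### Counting crossing edges of a sampled graph -/

section Counting

variable {N : ℕ}

theorem graphOf_adj_lt {r : Node N → Option (Node N)}
    (hr : ∀ v u, r v = some u → (u : ℕ) < v) (u v : Node N) (h : (graphOf r).Adj u v) :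
    (u : ℕ) < v := by
  rcases h with h | h
  · lia
  · exact hr v u h

theorem sinks_graphOf {r : Node N → Option (Node N)}
    (hr : ∀ v u, r v = some u → (u : ℕ) < v) (hN : 1 ≤ N) :
    sinks (graphOf r) = {⟨N, Finset.mem_Icc.mpr ⟨hN, le_rfl⟩⟩} := by
  ext v
  have hv := Finset.mem_Icc.mp v.2
  constructor
  · intro h
    by_contra hne
    have hlt : (v : ℕ) ≠ N := fun e => hne (Subtype.ext e)
    exact h ⟨v + 1, Finset.mem_Icc.mpr (by lia)⟩ (Or.inl rfl)
  · rintro rfl u hu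
    have h1 := graphOf_adj_lt hr _ _ hu
    have h2 := (Finset.mem_Icc.mp u.2).2
    simp only at h1
    lia

/-- The outcomes for `r(v)` that lie in an earlier group than `v`, provided that `v` is not among
the first `L` nodes of its group. -/
def farOutcomes (A L : ℕ) (v : Node N) : Set (Option (Node N)) :=
  {o | L ≤ (v : ℕ) % A ∧ ∃ u, o = some u ∧ (u : ℕ) / A < (v : ℕ) / A}

/-- The number of nodes outside the first `L` nodes of their group whose random predecessor lies
in an earlier group. -/
noncomputable def farCount (A L : ℕ) (r : Node N → Option (Node N)) : ℕ :=
  open scoped Classical in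
  (Finset.univ.filter fun v => r v ∈ farOutcomes A L v).card

theorem card_filter_mod_lt_le (A L : ℕ) :
    (Finset.univ.filter fun v : Node N => (v : ℕ) % A < L).card ≤ L * (N / A + 1) := by
  have hcard : L * (N / A + 1) = (Finset.range L ×ˢ Finset.range (N / A + 1)).card := by simp
  rw [hcard]
  refine Finset.card_le_card_of_injOn (fun v => ((v : ℕ) % A, (v : ℕ) / A)) (fun v hv => ?_) ?_
  · have h1 := (Finset.mem_Icc.mp v.2).2
    have h2 := (Nat.div_le_div_right h1 : (v : ℕ) / A ≤ N / A)
    simp only [Finset.coe_filter, Finset.mem_univ, true_and, Set.mem_ofPred_eq] at hv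
    simp only [Finset.coe_product, Set.mem_prod, Finset.mem_coe, Finset.mem_range]
    lia
  · intro v _ w _ h
    obtain ⟨h1, h2⟩ := Prod.mk.inj h
    exact Subtype.ext (by rw [← Nat.div_add_mod (v : ℕ) A, h1, h2, Nat.div_add_mod])

/-- The first `L` nodes of the groups are charged twice: for their random predecessors, and for path
edges, which cross only into a multiple of `A`. -/
theorem card_crossingTails_graphOf_le (r : Node N → Option (Node N)) (A : ℕ) {L : ℕ} (hL : 0 < L) :
    (crossingTails (graphOf r) A).card ≤ 2 * (L * (N / A + 1)) + farCount A L r := by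
  classical
  set S := Finset.univ.filter fun v : Node N => (v : ℕ) % A < L with hS
  set F := Finset.univ.filter fun v : Node N => r v ∈ farOutcomes A L v with hF
  set Spred := Finset.univ.filter fun u : Node N => ∃ v ∈ S, (u : ℕ) + 1 = v with hSpred
  have hsub : (crossingTails (graphOf r) A).image some ⊆
      Spred.image some ∪ (S ∪ F).image r := by
    intro o ho
    obtain ⟨u, hu, rfl⟩ := Finset.mem_image.mp ho
    obtain ⟨v, hadj, hlt⟩ := mem_crossingTails.mp hu
    rcases hadj with h | h
    · refine Finset.mem_union_left _ (Finset.mem_image_of_mem _ ?_)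
      simp only [hSpred, hS, Finset.mem_filter, Finset.mem_univ, true_and]
      refine ⟨v, ?_, h⟩
      have hd : A ∣ (u : ℕ) + 1 := by
        rw [← h, Nat.succ_div] at hlt
        split_ifs at hlt with hd
        · exact hd
        · lia
      rw [← h, Nat.mod_eq_zero_of_dvd hd]
      exact hL
    · refine Finset.mem_union_right _ (Finset.mem_image.mpr ⟨v, ?_, h⟩)
      simp only [hS, hF, Finset.mem_union, Finset.mem_filter, Finset.mem_univ, true_and]
      by_cases hv : (v : ℕ) % A < L
      · exact Or.inl hv
      · exact Or.inr ⟨not_lt.mp hv, u, h, hlt⟩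
  have hpredcard : Spred.card ≤ S.card := by
    have h : ∀ u ∈ Spred, ∃ v ∈ S, (u : ℕ) + 1 = v := fun u hu => (Finset.mem_filter.mp hu).2
    choose! f hf hf' using h
    refine Finset.card_le_card_of_injOn f hf fun u hu w hw e => Subtype.ext ?_
    have h1 := hf' u hu
    have h2 := hf' w hw
    rw [e] at h1
    lia
  have hScard : S.card ≤ L * (N / A + 1) := card_filter_mod_lt_le A L
  have hFcard : F.card = farCount A L r := rfl
  have h1 := Finset.card_le_card hsub
  rw [Finset.card_image_of_injective _ (Option.some_injective _)] at h1
  have h2 := Finset.card_union_le (Spred.image some) ((S ∪ F).image r)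
  have h3 := Finset.card_image_le (s := Spred) (f := some)
  have h4 := Finset.card_image_le (s := S ∪ F) (f := r)
  have h5 := Finset.card_union_le S F
  lia

theorem stComplexity_graphOf_le {r : Node N → Option (Node N)}
    (hr : ∀ v u, r v = some u → (u : ℕ) < v) (hN : 1 ≤ N) {A L : ℕ} (hA : 0 < A) (hL : 0 < L) :
    stComplexity (graphOf r) ≤
      (((4 * N + 1) * (2 * (L * (N / A + 1)) + farCount A L r + A + 1) : ℕ) : ℕ∞) := by
  rw [stComplexity, sinks_graphOf hr hN]
  refine (stComplexityTarget_last_le (graphOf_adj_lt hr) hA _).trans ?_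
  have := card_crossingTails_graphOf_le r A hL
  exact_mod_cast Nat.mul_le_mul_left _ (by lia)

end Counting

/-! ### The probability of crossing edges -/

section Probability

theorem productLaw_apply {ι α : Type} [Fintype ι] [DecidableEq ι] [Fintype α] (p : ι → PMF α)
    (ω : ι → α) : productLaw p ω = ∏ i, p i (ω i) := by
  simp [productLaw]

open scoped Classical in
/-- Exponential moment bound for the number of successes in independent trials. -/
theorem productLaw_le_card {ι α : Type} [Fintype ι] [Fintype α]
    (p : ι → PMF α) (s : ι → Set α) {q : ℝ} (hq : 0 ≤ q)
    (hp : ∀ i, (p i).toOuterMeasure (s i) ≤ ENNReal.ofReal q) (T : ℕ) :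
    (productLaw p).toOuterMeasure
        {ω | T ≤ (Finset.univ.filter fun i => ω i ∈ s i).card} ≤
      ENNReal.ofReal (Real.exp (2 * q * Fintype.card ι)) / 3 ^ T := by
  -- One trial contributes the moment `1 + 2 * P(success) ≤ exp (2 * q)`; independence multiplies
  -- these, and Markov's inequality concludes.
  have hfac : ∀ i, ∑ a, p i a * (if a ∈ s i then 3 else 1) ≤
      ENNReal.ofReal (Real.exp (2 * q)) := by
    intro i
    have h1 : ∀ a, p i a * (if a ∈ s i then 3 else 1) = p i a + 2 * (s i).indicator (p i) a := by
      intro a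
      by_cases h : a ∈ s i
      · simp only [h, if_true, Set.indicator_of_mem]; ring
      · simp [h]
    have h2 : ∑ a, p i a = 1 := by simpa only [tsum_fintype] using (p i).tsum_coe
    simp only [h1, Finset.sum_add_distrib, ← Finset.mul_sum, h2]
    rw [← PMF.toOuterMeasure_apply_fintype]
    calc 1 + 2 * (p i).toOuterMeasure (s i) ≤ 1 + 2 * ENNReal.ofReal q := by gcongr; exact hp i
      _ = ENNReal.ofReal (1 + 2 * q) := by
        rw [ENNReal.ofReal_add (by norm_num) (by positivity), ENNReal.ofReal_mul (by norm_num)]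
        simp
      _ ≤ _ := ENNReal.ofReal_le_ofReal (by linarith [Real.add_one_le_exp (2 * q)])
  have hmgf : ∑ ω, productLaw p ω * 3 ^ (Finset.univ.filter fun i => ω i ∈ s i).card ≤
      ENNReal.ofReal (Real.exp (2 * q * Fintype.card ι)) := by
    calc ∑ ω, productLaw p ω * 3 ^ (Finset.univ.filter fun i => ω i ∈ s i).card
        = ∑ ω : ι → α, ∏ i, p i (ω i) * (if ω i ∈ s i then 3 else 1) := by
          refine Finset.sum_congr rfl fun ω _ => ?_
          rw [productLaw_apply, Finset.prod_mul_distrib, Finset.prod_ite]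
          simp
      _ = ∏ i, ∑ a, p i a * (if a ∈ s i then 3 else 1) := by
          rw [Fintype.prod_sum]
      _ ≤ ∏ _i : ι, ENNReal.ofReal (Real.exp (2 * q)) := Finset.prod_le_prod' fun i _ => hfac i
      _ = _ := by
          rw [Finset.prod_const, ← ENNReal.ofReal_pow (Real.exp_pos _).le, ← Real.exp_nat_mul,
            Finset.card_univ]
          congr 2; ring
  rw [ENNReal.le_div_iff_mul_le (by simp) (by simp), PMF.toOuterMeasure_apply_fintype,
    Finset.sum_mul]
  refine (Finset.sum_le_sum fun ω _ => ?_).trans hmgf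
  by_cases h : T ≤ (Finset.univ.filter fun i => ω i ∈ s i).card
  · rw [Set.indicator_of_mem (by exact h)]
    gcongr
    norm_num
  · rw [Set.indicator_of_notMem (by exact h)]
    simp

variable {N : ℕ}

/-- A step back of at most `2 ^ i ≤ L ≤ v % A` cannot leave the group of `v`. -/
theorem toOuterMeasure_uniformOrNone_bucket_eq_zero {A L i : ℕ} {v : Node N} (hA : 0 < A)
    (hi : 2 ^ i ≤ L) : (uniformOrNone (bucket v i)).toOuterMeasure (farOutcomes A L v) = 0 := by
  rw [PMF.toOuterMeasure_apply_eq_zero_iff, Set.disjoint_left]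
  rintro o ho ⟨hL, u, rfl, hlt⟩
  rw [uniformOrNone] at ho
  split_ifs at ho with h
  · simp only [PMF.mem_support_map_iff, PMF.mem_support_uniformOfFinset_iff, Option.some.injEq,
      exists_eq_right] at ho
    simp only [bucket, Finset.mem_filter, Finset.mem_univ, true_and] at ho
    have h2 : ((v : ℕ) : ℤ) ≤ ((u : ℕ) : ℤ) + ((2 ^ i : ℕ) : ℤ) := by
      push_cast; linarith [ho.2]
    have h3 : A * ((v : ℕ) / A) ≤ u := by
      have := Nat.div_add_mod (v : ℕ) A
      lia
    have h4 : (v : ℕ) / A ≤ (u : ℕ) / A := (Nat.le_div_iff_mul_le hA).mpr (by linarith)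
    lia
  · simp at ho

theorem lt_of_mem_support_predecessorLaw {v u : Node N}
    (h : some u ∈ (predecessorLaw v).support) : (u : ℕ) < v := by
  rw [predecessorLaw, PMF.mem_support_bind_iff] at h
  obtain ⟨o, -, ho⟩ := h
  cases o with
  | none => simp at ho
  | some i =>
    simp only [uniformOrNone] at ho
    split_ifs at ho with h
    · simp only [PMF.mem_support_map_iff, PMF.mem_support_uniformOfFinset_iff, Option.some.injEq,
        exists_eq_right] at ho
      simp only [bucket, Finset.mem_filter, Finset.mem_univ, true_and] at ho
      have : (0 : ℤ) < 2 ^ (i - 1) := by positivity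
      lia
    · simp at ho

theorem toOuterMeasure_le_one {α : Type*} (p : PMF α) (s : Set α) : p.toOuterMeasure s ≤ 1 := by
  rw [PMF.toOuterMeasure_apply, ← p.tsum_coe]
  exact ENNReal.tsum_le_tsum fun a => Set.indicator_le_self _ _ _

/-- A node beyond the first `2 ^ a` nodes of its group has its random predecessor in an earlier
group with probability at most `(n - a) / n`, where `log v ≤ n`. -/
theorem predecessorLaw_farOutcomes_le {A a n : ℕ} (hA : 0 < A) (ha : 1 ≤ a) (han : a ≤ n)
    {v : Node N} (hv : Nat.log 2 v ≤ n) :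
    (predecessorLaw v).toOuterMeasure (farOutcomes A (2 ^ a) v) ≤
      ENNReal.ofReal (((n - a : ℕ) : ℝ) / n) := by
  by_cases hva : 2 ^ a ≤ (v : ℕ) % A
  swap
  · have : farOutcomes A (2 ^ a) v = ∅ := by
      ext o
      simp [farOutcomes, hva]
    simp [this]
  set m := Nat.log 2 v with hm
  have ham : a ≤ m := Nat.le_log_of_pow_le (by norm_num) (hva.trans (Nat.mod_le _ _))
  have hne : (bucketIndices v).Nonempty := ⟨1, Finset.mem_Icc.mpr ⟨le_rfl, by lia⟩⟩
  -- Short buckets stay inside the group, and indices above `m` are never drawn.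
  have hterm : ∀ i ∉ Finset.Icc (a + 1) m,
      PMF.uniformOfFinset (bucketIndices v) hne i *
        (uniformOrNone (bucket v i)).toOuterMeasure (farOutcomes A (2 ^ a) v) = 0 := by
    intro i hi
    by_cases hia : i ≤ a
    · rw [toOuterMeasure_uniformOrNone_bucket_eq_zero hA (Nat.pow_le_pow_right (by norm_num) hia),
        mul_zero]
    · rw [PMF.uniformOfFinset_apply_of_notMem, zero_mul]
      rw [bucketIndices, Finset.mem_Icc]
      rw [Finset.mem_Icc] at hi
      lia
  have hlaw : predecessorLaw v = (PMF.uniformOfFinset (bucketIndices v) hne).bind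
      fun i => uniformOrNone (bucket v i) := by
    rw [predecessorLaw, uniformOrNone, dif_pos hne, PMF.bind_map]
    rfl
  have hm0 : (0 : ℝ) < m := by exact_mod_cast (by lia : 0 < m)
  have hn0 : (0 : ℝ) < n := by exact_mod_cast (by lia : 0 < n)
  rw [hlaw, PMF.toOuterMeasure_bind_apply, tsum_eq_sum hterm]
  calc ∑ i ∈ Finset.Icc (a + 1) m, PMF.uniformOfFinset (bucketIndices v) hne i *
        (uniformOrNone (bucket v i)).toOuterMeasure (farOutcomes A (2 ^ a) v)
      ≤ ∑ i ∈ Finset.Icc (a + 1) m, (m : ℝ≥0∞)⁻¹ := by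
        refine Finset.sum_le_sum fun i hi => ?_
        rw [Finset.mem_Icc] at hi
        have hib : i ∈ bucketIndices v := Finset.mem_Icc.mpr (by lia)
        rw [PMF.uniformOfFinset_apply_of_mem _ hib]
        refine (mul_le_mul_right (toOuterMeasure_le_one _ _) _).trans ?_
        simp [bucketIndices, hm]
    _ = ENNReal.ofReal (((m - a : ℕ) : ℝ) / m) := by
        rw [Finset.sum_const, nsmul_eq_mul, ENNReal.ofReal_div_of_pos hm0, Nat.card_Icc,
          div_eq_mul_inv, ENNReal.ofReal_natCast, ENNReal.ofReal_natCast,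
          Nat.add_sub_add_right]
    _ ≤ ENNReal.ofReal (((n - a : ℕ) : ℝ) / n) := by
        refine ENNReal.ofReal_le_ofReal ?_
        rw [div_le_div_iff₀ hm0 hn0, Nat.cast_sub ham, Nat.cast_sub han]
        have : (m : ℝ) ≤ n := by exact_mod_cast hv
        nlinarith [(Nat.cast_nonneg a : (0 : ℝ) ≤ a)]

end Probability

/-! ### The space-time cost with high probability -/

/-- This keeps the exponent `n - 2 * l` positive; the inequality fails at `n = 4`. -/
theorem two_mul_log_lt {n : ℕ} (hn : 5 ≤ n) : 2 * Nat.log 2 n < n := by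
  have h := Nat.pow_log_le_self 2 (by lia : n ≠ 0)
  rcases le_or_gt (Nat.log 2 n) 2 with h2 | h2
  · lia
  · have key : ∀ l : ℕ, 3 ≤ l → 2 * l < 2 ^ l := by
      intro l hl
      induction l, hl using Nat.le_induction with
      | base => norm_num
      | succ l _ ih => rw [pow_succ]; lia
    exact (key _ h2).trans_le h

/-- The cost bound in terms of the parameters `n = ⌊log N⌋`, `l = ⌊log n⌋`. -/
theorem pebbling_cost_le {N n l f : ℕ} (hn : n = Nat.log 2 N) (hl : l = Nat.log 2 n) (hn5 : 5 ≤ n)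
    (hf : (f : ℝ) ≤ 6 * (N * l / n)) :
    (((4 * N + 1) * (2 * (2 ^ (n - 2 * l) * (N / 2 ^ (n - l) + 1)) + f + 2 ^ (n - l) + 1) : ℕ) : ℝ)
      ≤ 170 * ((N : ℝ) ^ 2 * Real.logb 2 (Real.logb 2 N) / Real.logb 2 N) := by
  have h2l : 2 * l < n := hl ▸ two_mul_log_lt hn5
  have hN0 : N ≠ 0 := by
    rintro rfl
    simp at hn
    lia
  have hl1 : 1 ≤ l := hl ▸ Nat.le_log_of_pow_le (by norm_num) (by lia)
  have hnN : 2 ^ n ≤ N := hn ▸ Nat.pow_log_le_self 2 hN0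
  have hNn : N < 2 ^ (n + 1) := hn ▸ Nat.lt_pow_succ_log_self (by norm_num) N
  have hln : 2 ^ l ≤ n := hl ▸ Nat.pow_log_le_self 2 (by lia)
  have hnl : n < 2 ^ (l + 1) := hl ▸ Nat.lt_pow_succ_log_self (by norm_num) n
  set A := 2 ^ (n - l) with hA
  have hgroups : N / A + 1 ≤ 2 ^ (l + 1) := by
    refine Nat.succ_le_of_lt (Nat.div_lt_of_lt_mul (hNn.trans_le ?_))
    rw [hA, ← pow_add]
    exact Nat.pow_le_pow_right (by norm_num) (by lia)
  have hheads : 2 ^ (n - 2 * l) * (N / A + 1) ≤ 2 * A := by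
    refine (Nat.mul_le_mul_left _ hgroups).trans_eq ?_
    rw [hA, ← pow_add, ← pow_succ']
    congr 1
    lia
  have hAn : A * n ≤ 2 * N := by
    calc A * n ≤ A * 2 ^ (l + 1) := Nat.mul_le_mul_left _ hnl.le
      _ = 2 * 2 ^ n := by
        rw [hA, ← pow_add, ← pow_succ']
        congr 1
        lia
      _ ≤ 2 * N := by lia
  have hnR : (0 : ℝ) < n := by exact_mod_cast (by lia : 0 < n)
  have hNR : (1 : ℝ) ≤ N := by exact_mod_cast Nat.one_le_iff_ne_zero.mpr hN0
  have hlR : (1 : ℝ) ≤ l := by exact_mod_cast hl1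
  set X : ℝ := N * l / n with hX
  have hAX : (A : ℝ) ≤ 2 * X := by
    rw [hX, mul_div_assoc', le_div_iff₀ hnR]
    have : (A : ℝ) * n ≤ 2 * N := by exact_mod_cast hAn
    nlinarith
  have h1X : 1 ≤ X := by
    rw [hX, le_div_iff₀ hnR]
    have : (n : ℝ) ≤ N := by exact_mod_cast (Nat.lt_two_pow_self.le.trans hnN)
    nlinarith
  have hlogN_le : Real.logb 2 N ≤ 2 * n := by
    have : Real.logb 2 N ≤ ((n + 1 : ℕ) : ℝ) := by
      rw [Real.logb_le_iff_le_rpow (by norm_num) (by linarith), Real.rpow_natCast]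
      exact_mod_cast hNn.le
    push_cast at this
    have : (1 : ℝ) ≤ n := by exact_mod_cast (by lia : 1 ≤ n)
    linarith
  have hle_logN : (n : ℝ) ≤ Real.logb 2 N := by
    rw [Real.le_logb_iff_rpow_le (by norm_num) (by linarith), Real.rpow_natCast]
    exact_mod_cast hnN
  have hlog0 : 0 < Real.logb 2 N := hnR.trans_le hle_logN
  have hle_loglog : (l : ℝ) ≤ Real.logb 2 (Real.logb 2 N) := by
    rw [Real.le_logb_iff_rpow_le (by norm_num) hlog0, Real.rpow_natCast]
    exact le_trans (by exact_mod_cast hln) hle_logN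
  have hXle : X ≤ 2 * (N * Real.logb 2 (Real.logb 2 N) / Real.logb 2 N) := by
    rw [hX, mul_div_assoc', div_le_div_iff₀ hnR hlog0]
    calc (N : ℝ) * l * Real.logb 2 N ≤ N * Real.logb 2 (Real.logb 2 N) * (2 * n) := by
          gcongr
          exact mul_nonneg (by linarith) (by linarith)
      _ = _ := by ring
  -- The sum is at most `4A + 6X + A + 1`, with `A ≤ 2X` and `1 ≤ X`.
  have hsum : (((2 * (2 ^ (n - 2 * l) * (N / A + 1)) + f + A + 1 : ℕ)) : ℝ) ≤ 17 * X := by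
    have : ((2 ^ (n - 2 * l) * (N / A + 1) : ℕ) : ℝ) ≤ 2 * A := by exact_mod_cast hheads
    rw [Nat.cast_add, Nat.cast_add, Nat.cast_add, Nat.cast_mul, Nat.cast_ofNat, Nat.cast_one]
    linarith
  rw [Nat.cast_mul]
  calc ((4 * N + 1 : ℕ) : ℝ) * ((2 * (2 ^ (n - 2 * l) * (N / A + 1)) + f + A + 1 : ℕ) : ℝ)
      ≤ (5 * N) * (17 * X) := by
        gcongr
        push_cast
        linarith
    _ ≤ (5 * N) * (17 * (2 * (N * Real.logb 2 (Real.logb 2 N) / Real.logb 2 N))) := by gcongr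
    _ = _ := by ring

theorem one_sub_toOuterMeasure_compl_le {α : Type*} (p : PMF α) (s : Set α) :
    1 - (p.toOuterMeasure sᶜ).toReal ≤ (p.toOuterMeasure s).toReal := by
  have h : p.toOuterMeasure Set.univ ≤ p.toOuterMeasure s + p.toOuterMeasure sᶜ := by
    rw [← Set.union_compl_self s]
    exact MeasureTheory.measure_union_le _ _
  rw [(p.toOuterMeasure_apply_eq_one_iff _).mpr (Set.subset_univ _)] at h
  have hs := ne_top_of_le_ne_top ENNReal.one_ne_top (toOuterMeasure_le_one p s)
  have hs' := ne_top_of_le_ne_top ENNReal.one_ne_top (toOuterMeasure_le_one p sᶜ)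
  have := ENNReal.toReal_mono (ENNReal.add_ne_top.mpr ⟨hs, hs'⟩) h
  rw [ENNReal.toReal_add hs hs', ENNReal.toReal_one] at this
  linarith

theorem lt_of_mem_support_productLaw {N : ℕ} {r : Node N → Option (Node N)}
    (h : r ∈ (productLaw fun v : Node N => predecessorLaw v).support) (v u : Node N)
    (hv : r v = some u) : (u : ℕ) < v := by
  rw [PMF.mem_support_iff, productLaw_apply, Finset.prod_ne_zero_iff] at h
  exact lt_of_mem_support_predecessorLaw (hv ▸ (PMF.mem_support_iff _ _).mpr
    (h v (Finset.mem_univ v)))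

/-- The probability that the group-by-group pebbling is too expensive is exponentially small. -/
theorem drSample_costly_le {N n l : ℕ} (hn : n = Nat.log 2 N) (hl : l = Nat.log 2 n)
    (hn5 : 5 ≤ n) :
    (drSample N).toOuterMeasure
        {G | (stComplexity G : ℝ≥0∞) ≤ ENNReal.ofReal
          (170 * ((N : ℝ) ^ 2 * Real.logb 2 (Real.logb 2 N) / Real.logb 2 N))}ᶜ ≤
      ENNReal.ofReal (Real.exp (-(2 * (N * l / n)))) := by
  have h2l : 2 * l < n := hl ▸ two_mul_log_lt hn5
  have hN0 : N ≠ 0 := by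
    rintro rfl
    simp at hn
    lia
  set X : ℝ := N * l / n with hX
  have hX0 : 0 ≤ X := by positivity
  set T := ⌈6 * X⌉₊ with hT
  rw [drSample, PMF.toOuterMeasure_map_apply]
  have hsub : (productLaw fun v : Node N => predecessorLaw v).toOuterMeasure
      (graphOf ⁻¹' {G | (stComplexity G : ℝ≥0∞) ≤ ENNReal.ofReal
          (170 * ((N : ℝ) ^ 2 * Real.logb 2 (Real.logb 2 N) / Real.logb 2 N))}ᶜ) ≤
      (productLaw fun v : Node N => predecessorLaw v).toOuterMeasure
        {r | T ≤ farCount (2 ^ (n - l)) (2 ^ (n - 2 * l)) r} := by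
    -- Only outcomes in the support matter; there edges go forward and `N` is the only sink.
    refine PMF.toOuterMeasure_mono _ ?_
    rintro r ⟨hr, hsupp⟩
    by_contra hlt
    refine hr ?_
    rw [Set.mem_ofPred_eq, not_le, hT, Nat.lt_ceil] at hlt
    have hst := stComplexity_graphOf_le (lt_of_mem_support_productLaw hsupp)
      (Nat.one_le_iff_ne_zero.mpr hN0) (A := 2 ^ (n - l)) (L := 2 ^ (n - 2 * l))
      (by positivity) (by positivity)
    have hcost := ENNReal.ofReal_le_ofReal (pebbling_cost_le hn hl hn5 hlt.le)
    rw [ENNReal.ofReal_natCast] at hcost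
    refine le_trans ?_ hcost
    exact_mod_cast (ENat.toENNReal_le.mpr hst)
  refine hsub.trans ((productLaw_le_card _ (fun v => farOutcomes (2 ^ (n - l)) (2 ^ (n - 2 * l)) v)
    (q := ((n - (n - 2 * l) : ℕ) : ℝ) / n) (by positivity) (fun v => ?_) T).trans ?_)
  · exact predecessorLaw_farOutcomes_le (by positivity) (by lia) (by lia)
      (hn ▸ Nat.log_mono_right (Finset.mem_Icc.mp v.2).2)
  · have hcard : Fintype.card (Node N) = N := by simp
    have hq : 2 * (((n - (n - 2 * l) : ℕ) : ℝ) / n) * (Fintype.card (Node N) : ℝ) = 4 * X := by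
      rw [hcard, show n - (n - 2 * l) = 2 * l by lia, hX]
      push_cast
      ring
    rw [hq]
    refine ENNReal.div_le_of_le_mul ?_
    have h3 : ((3 : ℝ≥0∞) ^ T) = ENNReal.ofReal (3 ^ T) := by
      rw [ENNReal.ofReal_pow (by norm_num)]
      norm_num
    rw [h3, ← ENNReal.ofReal_mul (Real.exp_pos _).le]
    refine ENNReal.ofReal_le_ofReal ?_
    -- Since `e < 3`, the tail bound `exp (4X) / 3 ^ T` is at most `exp (-2X)`.
    have hexp : Real.exp (6 * X) ≤ 3 ^ T := by
      calc Real.exp (6 * X) ≤ Real.exp (T : ℝ) := Real.exp_le_exp.mpr (Nat.le_ceil _)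
        _ = Real.exp 1 ^ T := by rw [← Real.exp_nat_mul, mul_one]
        _ ≤ 3 ^ T := by
          gcongr
          exact (Real.exp_one_lt_d9.trans (by norm_num)).le
    calc Real.exp (4 * X) = Real.exp (-(2 * X)) * Real.exp (6 * X) := by
          rw [← Real.exp_add]; ring_nf
      _ ≤ _ := by gcongr

/-- The exponent is at least of order `N / log N`, which exceeds `k * log N` once `(k + 1) * (log N)
^ 2 ≤ N`. -/
theorem eventually_exp_neg_le (k : ℕ) :
    ∀ᶠ N : ℕ in atTop, ∀ n l : ℕ, n = Nat.log 2 N → 1 ≤ n → 1 ≤ l →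
      Real.exp (-(2 * ((N : ℝ) * l / n))) ≤ 1 / (N : ℝ) ^ k := by
  have hlog := (Real.isLittleO_pow_log_id_atTop (n := 2)).bound
    (show (0 : ℝ) < 1 / (k + 1) by positivity)
  filter_upwards [tendsto_natCast_atTop_atTop.eventually hlog, eventually_ge_atTop 2]
    with N hN hN2 n l hn hn1 hl
  have hN0 : (0 : ℝ) < N := by positivity
  have hnR : (0 : ℝ) < n := by exact_mod_cast hn1
  have hlR : (1 : ℝ) ≤ l := by exact_mod_cast hl
  have hlogN : 0 < Real.log N := Real.log_pos (by exact_mod_cast hN2)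
  rw [id, Real.norm_of_nonneg (by positivity), Real.norm_of_nonneg hN0.le, div_mul_eq_mul_div,
    one_mul, le_div_iff₀ (by positivity)] at hN
  have hn_le : (n : ℝ) ≤ 2 * Real.log N := by
    have h : (n : ℝ) * Real.log 2 ≤ Real.log N := by
      rw [← Real.log_pow]
      refine Real.log_le_log (by positivity) ?_
      exact_mod_cast hn ▸ Nat.pow_log_le_self 2 (by lia : N ≠ 0)
    nlinarith [Real.log_two_gt_d9]
  have hkey : k * Real.log N ≤ 2 * ((N : ℝ) * l / n) := by
    rw [mul_div_assoc', le_div_iff₀ hnR]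
    calc k * Real.log N * n ≤ k * Real.log N * (2 * Real.log N) := by gcongr
      _ ≤ 2 * N := by nlinarith
      _ ≤ 2 * (N * l) := by nlinarith
  calc Real.exp (-(2 * ((N : ℝ) * l / n))) ≤ Real.exp (-(k * Real.log N)) := by
        gcongr
    _ = 1 / (N : ℝ) ^ k := by
        rw [Real.exp_neg, Real.exp_nat_mul, Real.exp_log hN0, one_div]

end QPebble

theorem mainTheorem5 :
    ∃ C : ℝ, 0 < C ∧ ∀ k : ℕ, ∀ᶠ N : ℕ in atTop,
      1 - 1 / (N : ℝ) ^ k ≤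
        ((QPebble.drSample N).toOuterMeasure
          {G | (QPebble.stComplexity G : ℝ≥0∞) ≤
            ENNReal.ofReal
              (C * ((N : ℝ) ^ 2 * Real.logb 2 (Real.logb 2 N) / Real.logb 2 N))}).toReal := by
  refine ⟨170, by norm_num, fun k => ?_⟩
  -- From `N ≥ 32 = 2 ^ 5` on, `n ≥ 5` holds, as the choice of `L` requires.
  filter_upwards [QPebble.eventually_exp_neg_le k, eventually_ge_atTop 32] with N hN hN32
  have hn5 : 5 ≤ Nat.log 2 N := Nat.le_log_of_pow_le (by norm_num) (by lia)
  have hl1 : 1 ≤ Nat.log 2 (Nat.log 2 N) := Nat.le_log_of_pow_le (by norm_num) (by lia)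
  refine le_trans ?_ (QPebble.one_sub_toOuterMeasure_compl_le _ _)
  have h := ENNReal.toReal_mono ENNReal.ofReal_ne_top (QPebble.drSample_costly_le rfl rfl hn5)
  rw [ENNReal.toReal_ofReal (Real.exp_pos _).le] at h
  linarith [hN _ _ rfl (by lia) hl1]
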